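/- **Conventions.** A finite simple graph is *strongly regular* with parameters $(v,k,\lambda,\mu)$ if it is neither complete nor edgeless, has $v$ vertices, is $k$-regular, and any two adjacent (resp. distinct non-adjacent) vertices have exactly $\lambda$ (resp. $\mu$) common neighbours. It is of *negative Latin square type* if $(v,k,\lambda,\mu)=(n^2,\,r(n+1),\,-n+r^2+3r,\,r^2+r)$ for some $n,r$. For a subset $D$ of an additive group $A$ with $0\notin D=-D$, $\mathrm{Cay}(A,D)$ is the graph on $A$ in which two vertices are adjacent iff their difference lies in $D$. **Setting.** Let $q$ be a prime power, $m\ge 3$, and let $\mathbb F_q^*\le C_0\le \mathbb F_{q^m}^*$ be a subgroup of index $e=[\mathbb F_{q^m}^*:C_0]$. Let $$H_0=\{x\mathbb F_q^* : x\in\mathbb F_{q^m}^*,\ \mathrm{Tr}_{q^m/q}(x)=0\}\subseteq \mathbb F_{q^m}^*/\mathbb F_q^*$$ be the Singer difference set, put $\overline{C_0}=C_0/\mathbb F_q^*$, and let $S$ be a complete system of coset representatives of $\overline{C_0}$ in $\mathbb F_{q^m}^*/\mathbb F_q^*$. Let $\gamma$ be a primitive element of $\mathbb F_{q^{2m}}$,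 let $\omega=\mathrm{N}_{q^{2m}/q^m}(\gamma)$, let $\overline\omega=\omega\mathbb F_q^*$, and let $C_i^{(e,q^{2m})}=\gamma^i\langle\gamma^e\rangle$. **Theorem.** Suppose that $-C_0=C_0$ and that $\mathrm{Cay}(\mathbb F_{q^m},C_0)$ is strongly regular. Then there is a (necessarily unique) nonzero integer $\delta$ such that the integers $|H_0\cap s\overline{C_0}|-|H_0\cap\overline{C_0}|$, $s\in S$, take exactly the two values $0$ and $\delta$. Put $$S'=\{s\in S : |H_0\cap s\overline{C_0}|-|H_0\cap\overline{C_0}|=\delta\},\qquad I=\{0\le i\le e-1 : \overline\omega^{\,i}\in s\overline{C_0}\text{ for some }s\in S'\},\qquad D=\bigcup_{i\in I}C_i^{(e,q^{2m})}.$$ Then $0\notin D$, $-D=D$, and $\mathrm{Cay}(\mathbb F_{q^{2m}},D)$ is a strongly regular graph of negative Latin square type. -/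

import Mathlib

open scoped Pointwise

noncomputable section

/-- A finite simple graph is strongly regular if it is neither edgeless nor complete and there are
`k, ℓ, μ` such that it is regular of degree `k`, any two adjacent vertices have exactly `ℓ` common
neighbours, and any two distinct non-adjacent vertices have exactly `μ` common neighbours. -/
def IsStronglyRegular {V : Type*} [Fintype V] (G : SimpleGraph V) : Prop :=
  open Classical in
  G ≠ ⊥ ∧ G ≠ ⊤ ∧ ∃ k l μ : ℕ, G.IsSRGWith (Fintype.card V) k l μ

/-- A strongly regular graph is of negative Latin square type if its parameters are
`(n ^ 2, r * (n + 1), -n + r ^ 2 + 3 * r, r ^ 2 + r)` for some `n` and `r`. -/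
def IsNegativeLatinSquareType {V : Type*} [Fintype V] (G : SimpleGraph V) : Prop :=
  open Classical in
  IsStronglyRegular G ∧
    ∃ n r l μ : ℕ, G.IsSRGWith (n ^ 2) (r * (n + 1)) l μ ∧
      (l : ℤ) = -n + r ^ 2 + 3 * r ∧ (μ : ℤ) = r ^ 2 + r

/-- The admissible connection sets of Cayley graphs on an additive group: `0 ∉ D` and `-D = D`.
For such `D`, two vertices of `SimpleGraph.addCayley D` are adjacent if and only if their
difference lies in `D`. -/
def IsConnectionSet {A : Type*} [AddGroup A] (D : Set A) : Prop :=
  (0 : A) ∉ D ∧ -D = D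

section Singer

variable (F K : Type*) [Field F] [Field K] [Algebra F K]

/-- The multiplicative group `F^*` as a subgroup of `K^*`. -/
def baseUnits : Subgroup Kˣ :=
  (Units.map (algebraMap F K : F →* K)).range

/-- The Singer difference set `H₀` in `K^* / F^*`: the set of classes of the elements of trace `0`.
Since the trace is `F`-linear, the condition does not depend on the representative of the
class. -/
def singerSet : Set (Kˣ ⧸ baseUnits F K) :=
  {y | ∃ x : Kˣ, Algebra.trace F K (x : K) = 0 ∧ (QuotientGroup.mk x : Kˣ ⧸ baseUnits F K) = y}

variable {K}

/-- The image `C₀ / F^*` of a subgroup `C₀` of `K^*` in `K^* / F^*`. -/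
def barSubgroup (C₀ : Subgroup Kˣ) : Subgroup (Kˣ ⧸ baseUnits F K) :=
  C₀.map (QuotientGroup.mk' (baseUnits F K))

/-- The integer `|H₀ ∩ s (C₀ / F^*)| - |H₀ ∩ (C₀ / F^*)|`. -/
def intersectionDiff (C₀ : Subgroup Kˣ) (s : Kˣ ⧸ baseUnits F K) : ℤ :=
  ((singerSet F K ∩ s • (barSubgroup F C₀ : Set (Kˣ ⧸ baseUnits F K))).ncard : ℤ) -
    ((singerSet F K ∩ (barSubgroup F C₀ : Set (Kˣ ⧸ baseUnits F K))).ncard : ℤ)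

/-- The set `S'` of those `s` in the system of representatives `S` for which
`|H₀ ∩ s (C₀ / F^*)| - |H₀ ∩ (C₀ / F^*)| = δ`. -/
def subdifferenceSet (C₀ : Subgroup Kˣ) (S : Set (Kˣ ⧸ baseUnits F K)) (δ : ℤ) :
    Set (Kˣ ⧸ baseUnits F K) :=
  {s ∈ S | intersectionDiff F C₀ s = δ}

/-- The set `I` of exponents `0 ≤ i ≤ e - 1` such that the class of `ω ^ i` belongs to `S'`
modulo `C₀ / F^*`, that is, lies in the coset `s (C₀ / F^*)` of some `s ∈ S'`. When `S` consists of
the classes of `1, ω, …, ω ^ (e - 1)`, this says that the class of `ω ^ i` is an element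
of `S'`. -/
def exponentSet (C₀ : Subgroup Kˣ) (S : Set (Kˣ ⧸ baseUnits F K)) (δ : ℤ) (ω : Kˣ) (e : ℕ) :
    Set ℕ :=
  {i | i < e ∧ ∃ s ∈ subdifferenceSet F C₀ S δ,
    (QuotientGroup.mk (ω ^ i) : Kˣ ⧸ baseUnits F K) ∈
      s • (barSubgroup F C₀ : Set (Kˣ ⧸ baseUnits F K))}

end Singer

/-- The elements of a subgroup of `K^*`, as a subset of `K`. -/
def unitsSet {K : Type*} [Field K] (C : Subgroup Kˣ) : Set K :=
  (fun u : Kˣ => (u : K)) '' (C : Set Kˣ)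

/-- The cyclotomic class `γ ^ i ⟨γ ^ e⟩` of order `e` of `K`. -/
def cyclotomicClass {K : Type*} [Field K] (γ : Kˣ) (e i : ℕ) : Set K :=
  (fun u : Kˣ => (u : K)) '' (γ ^ i • (Subgroup.zpowers (γ ^ e) : Set Kˣ))

end

/-! Write `Q` for the order of `K` and `X(y)` for the character sum of `C₀` at `y`. Averaging `X`
over the `F`-line through `y` detects trace zero, so `X(y) - X(1)` is `|F|` times the intersection
difference at `y` (`fourierSum_unitsSet_eq`). Strong regularity makes the values `X(y)`, `y ≠ 0`,
roots of one quadratic; Fourier inversion forbids a single value. Hence the differences are exactly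
`0` and some `δ ≠ 0`. Let `E` be the set where the difference is `δ`. The set `D` is its preimage
under the norm `N : L → K`. Completing the square in the Hermitian form `N` shows that the transform
of `x ↦ ψ(c N x)` at `a` is `-Q ψ(-c⁻¹ N a)`. As `c ↦ -c⁻¹` permutes `C₀`, summing over `c ∈ C₀`
makes `X ∘ N` an eigenfunction of the Fourier transform with eigenvalue `-Q`. Away from `0` it is an
affine function of the indicator of `D`, so the nontrivial character sums of `D` are `|E| - Q` on
`D` and `|E|` off `D` (`fourierSum_preimage_norm`). Inversion turns this into the negative Latin
square parameters with `n = Q`, `r = |E|`. -/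

open scoped Pointwise

/-! ### Fourier analysis on a finite field -/

section Fourier

variable {A : Type*} [Field A] [Fintype A]

/-- The Fourier transform `y ↦ ∑ x, f x * ψ (x * y)` of a complex function on a finite field. -/
noncomputable def fourierSum (ψ : AddChar A ℂ) (f : A → ℂ) (y : A) : ℂ :=
  ∑ x, f x * ψ (x * y)

/-- The additive convolution of two complex functions on a finite field. -/
noncomputable def addConvolution (f g : A → ℂ) (z : A) : ℂ :=
  ∑ x, f x * g (z - x)

open Classical in
theorem sum_addChar_mul {ψ : AddChar A ℂ} (hψ : ψ.IsPrimitive) (b : A) :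
    ∑ x, ψ (x * b) = if b = 0 then (Fintype.card A : ℂ) else 0 := by
  rw [AddChar.sum_mulShift b hψ]
  split_ifs <;> simp

/-- Fourier inversion, from orthogonality of characters. -/
theorem sum_fourierSum_mul {ψ : AddChar A ℂ} (hψ : ψ.IsPrimitive) (f : A → ℂ) (z : A) :
    ∑ y, fourierSum ψ f y * ψ (y * -z) = Fintype.card A * f z := by
  classical
  simp only [fourierSum, Finset.sum_mul]
  rw [Finset.sum_comm]
  have h : ∀ x : A, ∑ y, f x * ψ (x * y) * ψ (y * -z)
      = if x = z then f x * (Fintype.card A : ℂ) else 0 := by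
    intro x
    have h1 : ∀ y, f x * ψ (x * y) * ψ (y * -z) = f x * ψ (y * (x - z)) := by
      intro y
      rw [mul_assoc, ← AddChar.map_add_eq_mul]
      congr 2
      ring
    simp only [h1, ← Finset.mul_sum, sum_addChar_mul hψ, sub_eq_zero]
    split_ifs <;> simp
  simp only [h, Finset.sum_ite_eq', Finset.mem_univ, if_true]
  ring

theorem fourierSum_addConvolution (ψ : AddChar A ℂ) (f g : A → ℂ) (y : A) :
    fourierSum ψ (addConvolution f g) y = fourierSum ψ f y * fourierSum ψ g y := by
  simp only [fourierSum, addConvolution]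
  rw [Finset.sum_mul_sum]
  simp only [Finset.sum_mul]
  rw [Finset.sum_comm]
  refine Finset.sum_congr rfl fun x _ => ?_
  rw [← Equiv.sum_comp (Equiv.addRight x)]
  refine Finset.sum_congr rfl fun w _ => ?_
  simp only [Equiv.coe_addRight, add_sub_cancel_right, add_mul, AddChar.map_add_eq_mul]
  ring

end Fourier

/-! ### Cayley graphs, convolution and character sums -/

section Cayley

theorem IsConnectionSet.neg_mem_iff {A : Type*} [AddGroup A] {D : Set A}
    (hD : IsConnectionSet D) {x : A} : -x ∈ D ↔ x ∈ D := by
  rw [← Set.mem_neg, hD.2]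

theorem IsConnectionSet.addCayley_adj {A : Type*} [AddCommGroup A] {D : Set A}
    (hD : IsConnectionSet D) (u v : A) : (SimpleGraph.addCayley D).Adj u v ↔ v - u ∈ D := by
  rw [SimpleGraph.addCayley_adj, neg_add_eq_sub, neg_add_eq_sub]
  have h1 : u - v ∈ D ↔ v - u ∈ D := by rw [← hD.neg_mem_iff, neg_sub]
  rw [h1, or_self, and_iff_right_iff_imp]
  rintro h rfl
  exact hD.1 (by simpa using h)

theorem IsConnectionSet.ncard_neighborSet {A : Type*} [AddCommGroup A] {D : Set A}
    (hD : IsConnectionSet D) (v : A) : ((SimpleGraph.addCayley D).neighborSet v).ncard = D.ncard := by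
  rw [← Set.ncard_image_of_injective D (add_left_injective v)]
  congr 1
  ext x
  rw [SimpleGraph.mem_neighborSet, hD.addCayley_adj]
  constructor
  · exact fun h => ⟨_, h, by simp⟩
  · rintro ⟨y, hy, rfl⟩
    simpa using hy

variable {A : Type*} [Field A] [Fintype A] {D : Set A}

theorem sum_indicator_one {A : Type*} [Fintype A] (D : Set A) : ∑ x, D.indicator (1 : A → ℂ) x = D.ncard := by
  classical
  simp [Set.indicator_apply, Set.ncard_eq_toFinset_card']

/-- The common neighbours are the `x + v` with `x` and `w - v - x` both in `D`, by symmetry of `D`.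
-/
theorem IsConnectionSet.ncard_commonNeighbors (hD : IsConnectionSet D) (v w : A) :
    (((SimpleGraph.addCayley D).commonNeighbors v w).ncard : ℂ) =
      addConvolution (D.indicator 1) (D.indicator 1) (w - v) := by
  classical
  rw [← sum_indicator_one, addConvolution, ← Equiv.sum_comp (Equiv.addRight v)]
  refine Finset.sum_congr rfl fun x _ => ?_
  have h : x + v ∈ (SimpleGraph.addCayley D).commonNeighbors v w ↔ x ∈ D ∧ w - v - x ∈ D := by
    rw [SimpleGraph.mem_commonNeighbors, hD.addCayley_adj, hD.addCayley_adj,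
      add_sub_cancel_right, ← hD.neg_mem_iff (x := x + v - w)]
    congr! 2
    ring
  simp only [Set.indicator_apply, Equiv.coe_addRight, h, Pi.one_apply]
  split_ifs <;> simp_all

open Classical in
theorem IsConnectionSet.addConvolution_of_isSRGWith (hD : IsConnectionSet D) {n k l μ : ℕ}
    (h : (SimpleGraph.addCayley D).IsSRGWith n k l μ) (z : A) :
    addConvolution (D.indicator (1 : A → ℂ)) (D.indicator 1) z =
      if z = 0 then (k : ℂ) else if z ∈ D then (l : ℂ) else μ := by
  have hc := hD.ncard_commonNeighbors 0 z
  rw [sub_zero] at hc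
  rw [← hc]
  split_ifs with h0 h1
  · subst h0
    have := h.regular 0
    rw [← SimpleGraph.card_neighborSet_eq_degree, ← Nat.card_eq_fintype_card] at this
    rw [← this, Nat.card_coe_set_eq, SimpleGraph.commonNeighbors, Set.inter_self]
  · have := h.of_adj 0 z (by rwa [hD.addCayley_adj, sub_zero])
    rw [← Nat.card_eq_fintype_card, Nat.card_coe_set_eq] at this
    rw [this]
  · have := h.of_not_adj (Ne.symm h0) (by rwa [hD.addCayley_adj, sub_zero])
    rw [← Nat.card_eq_fintype_card, Nat.card_coe_set_eq] at this
    rw [this]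

open Classical in
theorem IsConnectionSet.isSRGWith (hD : IsConnectionSet D) {l μ : ℕ}
    (h : ∀ z ≠ 0, addConvolution (D.indicator (1 : A → ℂ)) (D.indicator 1) z =
      if z ∈ D then (l : ℂ) else μ) :
    (SimpleGraph.addCayley D).IsSRGWith (Fintype.card A) D.ncard l μ where
  card := rfl
  regular v := by
    rw [← SimpleGraph.card_neighborSet_eq_degree, ← Nat.card_eq_fintype_card,
      Nat.card_coe_set_eq, hD.ncard_neighborSet]
  of_adj v w hvw := by
    rw [← Nat.card_eq_fintype_card, Nat.card_coe_set_eq]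
    have h1 := hD.ncard_commonNeighbors v w
    rw [h _ (sub_ne_zero.2 hvw.ne'), if_pos ((hD.addCayley_adj v w).1 hvw)] at h1
    exact_mod_cast h1
  of_not_adj v w hne hvw := by
    rw [← Nat.card_eq_fintype_card, Nat.card_coe_set_eq]
    have h1 := hD.ncard_commonNeighbors v w
    rw [h _ (sub_ne_zero.2 hne.symm), if_neg (fun h => hvw ((hD.addCayley_adj v w).2 h))] at h1
    exact_mod_cast h1

/-- The nontrivial character sums over the connection set of a strongly regular Cayley graph are
roots of a quadratic equation. -/
theorem IsConnectionSet.exists_quadratic (hD : IsConnectionSet D)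
    (h : IsStronglyRegular (SimpleGraph.addCayley D)) {ψ : AddChar A ℂ} (hψ : ψ.IsPrimitive) :
    ∃ b c : ℂ, ∀ y ≠ 0, fourierSum ψ (D.indicator 1) y ^ 2 =
      b * fourierSum ψ (D.indicator 1) y + c := by
  classical
  obtain ⟨-, -, k, l, μ, h⟩ := h
  refine ⟨l - μ, k - μ, fun y hy => ?_⟩
  rw [sq, ← fourierSum_addConvolution]
  -- This is the adjacency matrix identity `A² = (l - μ)A + (k - μ)I + μJ`; the constant term has
  -- zero transform at `y ≠ 0`.
  have h1 : ∀ z, addConvolution (D.indicator (1 : A → ℂ)) (D.indicator 1) z =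
      (l - μ) * D.indicator 1 z + (k - μ) * (if z = 0 then 1 else 0) + μ := by
    intro z
    have := hD.addConvolution_of_isSRGWith (by convert h) z
    rw [this, Set.indicator_apply]
    have := hD.1
    split_ifs <;> simp_all
  have h2 : ∑ z, ψ (z * y) = 0 := by rw [sum_addChar_mul hψ, if_neg hy]
  simp only [fourierSum, h1, add_mul, Finset.sum_add_distrib, mul_assoc, ← Finset.mul_sum, h2]
  simp

/-- A proper nonempty set of nonzero elements has a nonconstant Fourier transform. -/
theorem exists_fourierSum_ne {ψ : AddChar A ℂ} (hψ : ψ.IsPrimitive)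
    (h1 : (1 : A) ∈ D) {z : A} (hz : z ≠ 0) (hzD : z ∉ D) (t : ℂ) :
    ∃ y ≠ 0, fourierSum ψ (D.indicator 1) y ≠ t := by
  classical
  by_contra! hc
  -- A transform constant off `0` inverts to a function constant off `0`, yet the indicator differs
  -- at `1` and `z`.
  have key : ∀ w : A, Fintype.card A * D.indicator (1 : A → ℂ) w =
      (fourierSum ψ (D.indicator 1) 0 - t) + t * (if w = 0 then (Fintype.card A : ℂ) else 0) := by
    intro w
    rw [← sum_fourierSum_mul hψ]
    have : ∀ y, fourierSum ψ (D.indicator 1) y * ψ (y * -w) =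
        (if y = 0 then (fourierSum ψ (D.indicator 1) 0 - t) else 0) + t * ψ (y * -w) := by
      intro y
      split_ifs with hy
      · simp [hy]
      · rw [hc y hy, zero_add]
    simp only [this, Finset.sum_add_distrib, ← Finset.mul_sum, sum_addChar_mul hψ]
    simp
  have hA : (Fintype.card A : ℂ) ≠ 0 := by simp
  have k1 := key 1
  have k2 := key z
  simp only [Set.indicator_of_mem h1, Set.indicator_of_notMem hzD, hz, one_ne_zero, if_false,
    Pi.one_apply, mul_one, mul_zero, add_zero] at k1 k2
  exact hA (k1.trans k2.symm)

/-- A connection set of size `r (n + 1)` in a field of order `n ^ 2`, whose nontrivial character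
sums are `r - n` on the set and `r` off the set, defines a strongly regular Cayley graph of negative
Latin square type. -/
theorem IsConnectionSet.isNegativeLatinSquareType (hD : IsConnectionSet D) {n r : ℕ}
    (hcard : Fintype.card A = n ^ 2) (hDcard : D.ncard = r * (n + 1))
    {d z : A} (hd : d ∈ D) (hz : z ≠ 0) (hzD : z ∉ D)
    {ψ : AddChar A ℂ} (hψ : ψ.IsPrimitive)
    (hsum : ∀ y ≠ 0, fourierSum ψ (D.indicator 1) y = r - n * D.indicator (1 : A → ℂ) y) :
    IsNegativeLatinSquareType (SimpleGraph.addCayley D) := by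
  classical
  have hn : (n : ℂ) ≠ 0 := by
    rintro h
    have : n = 0 := by exact_mod_cast h
    subst this
    simp at hcard
  set f : A → ℂ := D.indicator 1 with hf
  have hff : ∀ x, f x ^ 2 = f x := by
    intro x
    rw [hf, Set.indicator_apply]
    split_ifs <;> simp
  have hf0 : f 0 = 0 := Set.indicator_of_notMem hD.1 _
  have hfneg : ∀ x, f (-x) = f x := fun x => by
    simp only [hf, Set.indicator_apply, hD.neg_mem_iff, Pi.one_apply]
  have hsum0 : fourierSum ψ f 0 = r * (n + 1) := by
    simp only [fourierSum, mul_zero, AddChar.map_zero_eq_one, mul_one]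
    rw [hf, sum_indicator_one, hDcard]
    push_cast
    rfl
  -- Off `0` this is `(r - n f)²` with `f² = f`; the last term corrects the value at `0` to `r² (n +
  -- 1)²`.
  have hall : ∀ y, fourierSum ψ f y ^ 2 =
      r ^ 2 + (n ^ 2 - 2 * r * n) * f y + r ^ 2 * (n ^ 2 + 2 * n) * (if y = 0 then 1 else 0) := by
    intro y
    split_ifs with hy
    · rw [hy, hsum0, hf0]
      ring
    · rw [hsum y hy]
      linear_combination (n : ℂ) ^ 2 * hff y
  have hconv : ∀ w ≠ 0, addConvolution f f w = r ^ 2 + r + (2 * r - n) * f w := by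
    intro w hw
    have h1 := sum_fourierSum_mul hψ (addConvolution f f) w
    have h2 : ∀ y, fourierSum ψ (addConvolution f f) y * ψ (y * -w) =
        r ^ 2 * ψ (y * -w) + (n ^ 2 - 2 * r * n) * (f y * ψ (y * -w)) +
          r ^ 2 * (n ^ 2 + 2 * n) * (if y = 0 then 1 else 0) := by
      intro y
      rw [fourierSum_addConvolution, ← sq, hall]
      split_ifs with hy
      · rw [hy, zero_mul, AddChar.map_zero_eq_one]
        ring
      · ring
    have h3 : ∑ y, f y * ψ (y * -w) = r - n * f w := by
      have := hsum (-w) (neg_ne_zero.2 hw)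
      rwa [hfneg] at this
    simp only [h2, Finset.sum_add_distrib, ← Finset.mul_sum, h3, sum_addChar_mul hψ,
      neg_eq_zero, hw, if_false, hcard] at h1
    simp only [Finset.sum_ite_eq', Finset.mem_univ, if_true] at h1
    push_cast at h1
    have hn2 : (n : ℂ) ^ 2 ≠ 0 := pow_ne_zero 2 hn
    apply mul_left_cancel₀ hn2
    linear_combination -h1
  have hd0 : d ≠ 0 := by
    rintro rfl
    exact hD.1 hd
  -- The expression is a natural number because it counts the common neighbours of `0` and `d`.
  obtain ⟨l, hl⟩ : ∃ l : ℕ, (l : ℂ) = -n + r ^ 2 + 3 * r := by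
    have h1 := hD.ncard_commonNeighbors 0 d
    rw [sub_zero, hconv d hd0, hf, Set.indicator_of_mem hd] at h1
    refine ⟨_, h1.trans ?_⟩
    simp only [Pi.one_apply]
    ring
  have hsrg : (SimpleGraph.addCayley D).IsSRGWith (Fintype.card A) D.ncard l (r ^ 2 + r) := by
    refine hD.isSRGWith fun w hw => ?_
    rw [← hf, hconv w hw, hf, Set.indicator_apply]
    split_ifs
    · rw [hl, Pi.one_apply]
      ring
    · push_cast
      ring
  refine ⟨⟨?_, ?_, _, _, _, by convert hsrg⟩, n, r, l, r ^ 2 + r, ?_, ?_, by push_cast; rfl⟩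
  · intro h
    have : (SimpleGraph.addCayley D).Adj 0 d := by rwa [hD.addCayley_adj, sub_zero]
    rw [h] at this
    exact this
  · intro h
    have : (SimpleGraph.addCayley D).Adj 0 z := by
      rw [h]
      exact hz.symm
    rw [hD.addCayley_adj, sub_zero] at this
    exact hzD this
  · rw [← hcard, ← hDcard]
    convert hsrg
  · have : ((l : ℤ) : ℂ) = ((-n + r ^ 2 + 3 * r : ℤ) : ℂ) := by
      push_cast
      exact hl
    exact_mod_cast this

end Cayley

/-! ### Characters lifted through the trace -/

section Trace

variable {F K : Type*} [Field F] [Field K] [Algebra F K]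

variable (K) in
/-- The additive character of an extension obtained by composing with the trace. -/
noncomputable def traceChar (ψ : AddChar F ℂ) : AddChar K ℂ :=
  ψ.compAddMonoidHom (Algebra.trace F K).toAddMonoidHom

theorem traceChar_apply (ψ : AddChar F ℂ) (x : K) :
    traceChar K ψ x = ψ (Algebra.trace F K x) := rfl

theorem isPrimitive_traceChar [Finite F] [Finite K] {ψ : AddChar F ℂ} (hψ : ψ.IsPrimitive) :
    (traceChar K ψ).IsPrimitive := by
  apply AddChar.IsPrimitive.of_ne_one
  have h1 : ψ ≠ 1 := by simpa using hψ one_ne_zero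
  obtain ⟨a, ha⟩ := AddChar.ne_one_iff.1 h1
  obtain ⟨x, rfl⟩ := Algebra.trace_surjective F K a
  exact AddChar.ne_one_iff.2 ⟨x, ha⟩

end Trace

/-! ### Character sums over a multiplicative subgroup -/

section UnitsSet

variable {K : Type*} [Field K]

theorem coe_mem_unitsSet {C : Subgroup Kˣ} {u : Kˣ} : (u : K) ∈ unitsSet C ↔ u ∈ C := by
  constructor
  · rintro ⟨v, hv, h⟩
    rwa [← Units.ext h]
  · exact fun h => ⟨u, h, rfl⟩

theorem zero_notMem_unitsSet (C : Subgroup Kˣ) : (0 : K) ∉ unitsSet C := by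
  rintro ⟨u, -, h⟩
  exact u.ne_zero h

theorem one_mem_unitsSet (C : Subgroup Kˣ) : (1 : K) ∈ unitsSet C :=
  ⟨1, C.one_mem, rfl⟩

theorem inv_mem_unitsSet_iff {C : Subgroup Kˣ} {x : K} : x⁻¹ ∈ unitsSet C ↔ x ∈ unitsSet C := by
  rcases eq_or_ne x 0 with rfl | hx
  · simp
  · lift x to Kˣ using hx.isUnit
    rw [← Units.val_inv_eq_inv_val, coe_mem_unitsSet, coe_mem_unitsSet, inv_mem_iff]

theorem mul_mem_unitsSet_iff {C : Subgroup Kˣ} {c x : K} (hc : c ∈ unitsSet C) :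
    x * c ∈ unitsSet C ↔ x ∈ unitsSet C := by
  obtain ⟨u, hu, rfl⟩ := hc
  rcases eq_or_ne x 0 with rfl | hx
  · simp
  · lift x to Kˣ using hx.isUnit
    simp only [← Units.val_mul, coe_mem_unitsSet]
    exact C.mul_mem_cancel_right hu

variable [Fintype K]

theorem fourierSum_unitsSet_mul (ψ : AddChar K ℂ) {C : Subgroup Kˣ} {c : K}
    (hc : c ∈ unitsSet C) (y : K) :
    fourierSum ψ ((unitsSet C).indicator 1) (c * y) =
      fourierSum ψ ((unitsSet C).indicator 1) y := by
  have hc0 : c ≠ 0 := fun h => zero_notMem_unitsSet C (h ▸ hc)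
  unfold fourierSum
  rw [← Equiv.sum_comp (Equiv.mulRight₀ c hc0) (fun x => (unitsSet C).indicator 1 x * ψ (x * y))]
  refine Finset.sum_congr rfl fun x _ => ?_
  classical
  simp only [Equiv.mulRight₀_apply, Set.indicator_apply, mul_mem_unitsSet_iff hc, mul_assoc,
    Pi.one_apply]

theorem fourierSum_indicator_zero (ψ : AddChar K ℂ) (D : Set K) :
    fourierSum ψ (D.indicator 1) 0 = D.ncard := by
  simp [fourierSum, sum_indicator_one]

end UnitsSet

/-! ### The Singer set and trace-zero counts -/

section Singer

variable {F K : Type*} [Field F] [Field K] [Fintype F] [Fintype K] [Algebra F K]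

theorem mk_mem_smul_barSubgroup {F K : Type*} [Field F] [Field K] [Algebra F K]
    {C₀ : Subgroup Kˣ} (hF : baseUnits F K ≤ C₀) (x y : Kˣ) :
    (QuotientGroup.mk y : Kˣ ⧸ baseUnits F K) ∈ (QuotientGroup.mk x : Kˣ ⧸ baseUnits F K) •
      (barSubgroup F C₀ : Set (Kˣ ⧸ baseUnits F K)) ↔ x⁻¹ * y ∈ C₀ := by
  constructor
  · rintro ⟨_, ⟨c, hc, rfl⟩, h⟩
    have := hF (QuotientGroup.eq.1 (h : QuotientGroup.mk (x * c) = _))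
    rw [mul_inv_rev, mul_assoc] at this
    exact (C₀.mul_mem_cancel_left (C₀.inv_mem hc)).1 this
  · exact fun h => ⟨_, ⟨_, h, rfl⟩, congrArg QuotientGroup.mk (mul_inv_cancel_left x y)⟩

theorem preimage_singerSet_inter {F K : Type*} [Field F] [Field K] [Algebra F K]
    (C₀ : Subgroup Kˣ) (hF : baseUnits F K ≤ C₀) (y : Kˣ) :
    (QuotientGroup.mk : Kˣ → Kˣ ⧸ baseUnits F K) ⁻¹' (singerSet F K ∩
      (QuotientGroup.mk y : Kˣ ⧸ baseUnits F K) • (barSubgroup F C₀ : Set (Kˣ ⧸ baseUnits F K))) =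
    {u : Kˣ | Algebra.trace F K (u : K) = 0 ∧ y⁻¹ * u ∈ C₀} := by
  ext u
  simp only [Set.mem_preimage, Set.mem_inter_iff, Set.mem_ofPred_eq]
  refine and_congr ⟨?_, fun h => ⟨u, h, rfl⟩⟩ (mk_mem_smul_barSubgroup hF y u)
  rintro ⟨x, hx, hxu⟩
  obtain ⟨t, ht⟩ := QuotientGroup.eq.1 hxu
  have : (u : K) = (t : F) • (x : K) := by
    rw [eq_inv_mul_iff_mul_eq] at ht
    rw [← ht, Algebra.smul_def, mul_comm]
    rfl
  rw [this, map_smul, hx, smul_zero]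

/-- Both conditions are invariant under `F^*`, so the count upstairs is `|F^*|` times the count of
classes. -/
theorem ncard_trace_zero (C₀ : Subgroup Kˣ) (hF : baseUnits F K ≤ C₀) (y : Kˣ) :
    {x : K | x ∈ unitsSet C₀ ∧ Algebra.trace F K (x * y) = 0}.ncard =
      (Fintype.card F - 1) * (singerSet F K ∩ (QuotientGroup.mk y : Kˣ ⧸ baseUnits F K) •
        (barSubgroup F C₀ : Set (Kˣ ⧸ baseUnits F K))).ncard := by
  have h1 : {x : K | x ∈ unitsSet C₀ ∧ Algebra.trace F K (x * y) = 0} =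
      (fun u : Kˣ => ((u * y⁻¹ : Kˣ) : K)) ''
        {u : Kˣ | Algebra.trace F K (u : K) = 0 ∧ y⁻¹ * u ∈ C₀} := by
    ext x
    constructor
    · rintro ⟨⟨u, hu, rfl⟩, h⟩
      exact ⟨u * y, ⟨by simpa using h, by simpa [mul_comm] using hu⟩, by simp⟩
    · rintro ⟨u, ⟨h, hu⟩, rfl⟩
      refine ⟨coe_mem_unitsSet.2 (by rwa [mul_comm]), ?_⟩
      rw [← Units.val_mul, inv_mul_cancel_right, h]
  have hinj : Function.Injective (fun u : Kˣ => ((u * y⁻¹ : Kˣ) : K)) := fun u v h =>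
    mul_right_cancel (Units.ext h)
  have hbase : Nat.card (baseUnits F K) = Fintype.card F - 1 := by
    classical
    rw [baseUnits, Nat.card_congr (MonoidHom.ofInjective (Units.map_injective
      (f := (algebraMap F K : F →* K)) (algebraMap F K).injective)).toEquiv.symm,
      Nat.card_eq_fintype_card, Fintype.card_units]
  have h2 := Nat.card_congr (QuotientGroup.preimageMkEquivSubgroupProdSet (baseUnits F K)
    (singerSet F K ∩ (QuotientGroup.mk y : Kˣ ⧸ baseUnits F K) •
      (barSubgroup F C₀ : Set (Kˣ ⧸ baseUnits F K))))
  rw [Nat.card_prod, hbase, Nat.card_coe_set_eq, Nat.card_coe_set_eq,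
    preimage_singerSet_inter C₀ hF y] at h2
  rw [h1, Set.ncard_image_of_injective _ hinj, h2]

/-- The character sums over `C₀` in terms of the intersection numbers of the Singer set. -/
theorem fourierSum_unitsSet_eq {ψ : AddChar F ℂ} (hψ : ψ.IsPrimitive)
    (C₀ : Subgroup Kˣ) (hF : baseUnits F K ≤ C₀) (y : Kˣ) :
    fourierSum (traceChar K ψ) ((unitsSet C₀).indicator 1) y =
      fourierSum (traceChar K ψ) ((unitsSet C₀).indicator 1) 1 +
        Fintype.card F * intersectionDiff F C₀ (QuotientGroup.mk y) := by
  classical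
  set X := fourierSum (traceChar K ψ) ((unitsSet C₀).indicator 1) with hX
  -- The sum of `X` over the multiples `t y`, `t ∈ F`, is computed twice: `X` is constant for `t ≠
  -- 0` since `F^* ≤ C₀`, and orthogonality over `t` selects the `x` with trace of `x y` zero.
  have key : ∀ y : Kˣ, (unitsSet C₀).ncard + (Fintype.card F - 1 : ℂ) * X y =
      Fintype.card F * ((Fintype.card F - 1 : ℂ) *
        (singerSet F K ∩ (QuotientGroup.mk y : Kˣ ⧸ baseUnits F K) •
          (barSubgroup F C₀ : Set (Kˣ ⧸ baseUnits F K))).ncard) := by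
    intro y
    have h1 : ∑ t : F, X (algebraMap F K t * y) =
        (unitsSet C₀).ncard + (Fintype.card F - 1 : ℂ) * X y := by
      rw [← Finset.add_sum_erase _ _ (Finset.mem_univ (0 : F)), map_zero, zero_mul, hX,
        fourierSum_indicator_zero, ← hX]
      congr 1
      rw [Finset.sum_congr rfl (g := fun _ => X y), Finset.sum_const,
        Finset.card_erase_of_mem (Finset.mem_univ _), Finset.card_univ, nsmul_eq_mul,
        Nat.cast_sub Fintype.card_pos, Nat.cast_one]
      intro t ht
      have ht0 : t ≠ 0 := Finset.ne_of_mem_erase ht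
      exact fourierSum_unitsSet_mul _ ⟨_, hF ⟨Units.mk0 t ht0, rfl⟩, rfl⟩ _
    have h2 : ∑ t : F, X (algebraMap F K t * y) = Fintype.card F *
        {x : K | x ∈ unitsSet C₀ ∧ Algebra.trace F K (x * y) = 0}.ncard := by
      simp only [hX, fourierSum]
      rw [Finset.sum_comm, ← sum_indicator_one, Finset.mul_sum]
      refine Finset.sum_congr rfl fun x _ => ?_
      have h3 : ∀ t : F, traceChar K ψ (x * (algebraMap F K t * y)) =
          ψ (t * Algebra.trace F K (x * y)) := by
        intro t
        rw [traceChar_apply, mul_left_comm, ← Algebra.smul_def, map_smul, smul_eq_mul]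
      simp only [h3, ← Finset.mul_sum, sum_addChar_mul hψ, Set.indicator_apply, Set.mem_ofPred_eq]
      split_ifs <;> simp_all
    rw [← h1, h2, ncard_trace_zero C₀ hF y, Nat.cast_mul, Nat.cast_sub Fintype.card_pos,
      Nat.cast_one]
  have hq : (Fintype.card F - 1 : ℂ) ≠ 0 := by
    rw [sub_ne_zero]
    exact_mod_cast (Fintype.one_lt_card (α := F)).ne'
  have k1 := key y
  have k2 := key 1
  rw [QuotientGroup.mk_one, one_smul, Units.val_one] at k2
  apply mul_left_cancel₀ hq
  rw [intersectionDiff]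
  push_cast
  linear_combination k1 - k2

end Singer

/-! ### The norm of a quadratic extension -/

section Norm

variable {K L : Type*} [Field K] [Field L] [Fintype K] [Fintype L] [Algebra K L]

theorem sum_eq_zero_add_sum_units {M : Type*} [Field M] [Fintype M] [DecidableEq M] (h : M → ℂ) :
    ∑ x, h x = h 0 + ∑ u : Mˣ, h u := by
  rw [← Finset.add_sum_erase _ _ (Finset.mem_univ (0 : M))]
  congr 1
  symm
  refine Finset.sum_bij (fun u _ => (u : M)) ?_ ?_ ?_ ?_
  · exact fun u _ => Finset.mem_erase.2 ⟨u.ne_zero, Finset.mem_univ _⟩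
  · exact fun u _ v _ h => Units.ext h
  · exact fun x hx => ⟨Units.mk0 x (Finset.ne_of_mem_erase hx), Finset.mem_univ _, rfl⟩
  · exact fun _ _ => rfl

/-- The norm is onto with fibres of size `|K| + 1` over units, while only `0` lies over `0`. -/
theorem sum_comp_norm (hL : Module.finrank K L = 2) (g : K → ℂ) :
    ∑ x : L, g (Algebra.norm K x) = (Fintype.card K + 1) * ∑ y, g y - Fintype.card K * g 0 := by
  classical
  have hcard : Fintype.card L = Fintype.card K ^ 2 := by
    rw [Module.card_eq_pow_finrank (K := K), hL]
  set N : Lˣ →* Kˣ := Units.map (Algebra.norm K : L →* K) with hN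
  have hsurj : Function.Surjective N := FiniteField.unitsMap_norm_surjective K L
  set n := (Finset.univ.filter fun u : Lˣ => N u = 1).card
  have hfib : ∀ v : Kˣ, (Finset.univ.filter fun u : Lˣ => N u = v).card = n := fun v =>
    MonoidHom.card_fiber_eq_of_mem_range N (hsurj v) (hsurj 1)
  have hunits : ∀ h : Kˣ → ℂ, ∑ u : Lˣ, h (N u) = n * ∑ v, h v := by
    intro h
    rw [← Finset.sum_fiberwise (s := Finset.univ) (g := N), Finset.mul_sum]
    refine Finset.sum_congr rfl fun v _ => ?_
    rw [Finset.sum_congr rfl (g := fun _ => h v), Finset.sum_const, hfib, nsmul_eq_mul]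
    intro u hu
    rw [(Finset.mem_filter.1 hu).2]
  have hK : (Fintype.card K - 1 : ℂ) ≠ 0 := by
    rw [sub_ne_zero]
    exact_mod_cast (Fintype.one_lt_card (α := K)).ne'
  have hn' : (n : ℂ) = Fintype.card K + 1 := by
    have h1 := hunits fun _ => 1
    simp only [Finset.sum_const, Finset.card_univ, Fintype.card_units, nsmul_eq_mul, mul_one,
      Nat.cast_sub (Fintype.card_pos (α := K)), Nat.cast_sub (Fintype.card_pos (α := L)),
      Nat.cast_one] at h1
    rw [hcard, Nat.cast_pow] at h1
    apply mul_right_cancel₀ hK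
    linear_combination -h1
  rw [sum_eq_zero_add_sum_units, sum_eq_zero_add_sum_units g, Algebra.norm_zero]
  have := hunits fun v => g v
  rw [hn'] at this
  simp only [hN, Units.coe_map] at this
  rw [show (∑ u : Lˣ, g (Algebra.norm K (u : L))) = _ from this]
  ring

/-- Completing the square: with `Q = |K|` and `b = a^Q / c`, the cross term of `N(x + b)` is the
trace of `x b^Q`, and `b^Q = a / c`. -/
theorem norm_add_div (hL : Module.finrank K L = 2) {c : K} (hc : c ≠ 0) (a x : L) :
    c * Algebra.norm K (x + a ^ Fintype.card K / algebraMap K L c) =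
      c * Algebra.norm K x + Algebra.trace K L (x * a) + Algebra.norm K a / c := by
  have hnorm : ∀ z : L, algebraMap K L (Algebra.norm K z) = z * z ^ Fintype.card K := by
    intro z
    rw [FiniteField.algebraMap_norm_eq_prod_pow, hL]
    simp [Finset.prod_range_succ]
  have htr : ∀ z : L, algebraMap K L (Algebra.trace K L z) = z + z ^ Fintype.card K := by
    intro z
    rw [FiniteField.algebraMap_trace_eq_sum_pow, hL]
    simp [Finset.sum_range_succ]
  have hfrob : ∀ z w : L, (z + w) ^ Fintype.card K = z ^ Fintype.card K + w ^ Fintype.card K :=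
    fun z w => map_add (FiniteField.frobeniusAlgHom K L) z w
  have ha : (a ^ Fintype.card K) ^ Fintype.card K = a := by
    rw [← pow_mul, ← sq, ← hL, ← Module.card_eq_pow_finrank, FiniteField.pow_card]
  have hcc : (algebraMap K L c) ^ Fintype.card K = algebraMap K L c := by
    rw [← map_pow, FiniteField.pow_card]
  have hc' : algebraMap K L c ≠ 0 := by simpa using hc
  apply (algebraMap K L).injective
  simp only [map_add, map_mul, map_div₀, hnorm, htr, hfrob, div_pow, ha, hcc, mul_pow]
  field_simp
  ring

theorem sum_addChar_norm_add_trace (hL : Module.finrank K L = 2) {ψ : AddChar K ℂ}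
    (hψ : ψ.IsPrimitive) {c : K} (hc : c ≠ 0) (a : L) :
    ∑ x : L, ψ (Algebra.norm K x * c) * traceChar L ψ (x * a) =
      -Fintype.card K * ψ (-c⁻¹ * Algebra.norm K a) := by
  classical
  have h1 : ∑ x : L, ψ (Algebra.norm K x * c) = -Fintype.card K := by
    rw [sum_comp_norm hL (fun y => ψ (y * c)), sum_addChar_mul hψ, if_neg hc]
    simp
  rw [← h1, ← Equiv.sum_comp (Equiv.addRight (a ^ Fintype.card K / algebraMap K L c))
    (fun x => ψ (Algebra.norm K x * c)), Finset.sum_mul]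
  refine Finset.sum_congr rfl fun x _ => ?_
  rw [mul_comm _ c, mul_comm _ c, Equiv.coe_addRight, norm_add_div hL hc, traceChar_apply,
    ← AddChar.map_add_eq_mul, ← AddChar.map_add_eq_mul]
  congr 1
  ring

/-- If the character sums over `C₀` take two values, distinguished by the set `E`, then the
character sums over the preimage of `E` under the norm take two values, distinguished by that
preimage. -/
theorem fourierSum_preimage_norm (hL : Module.finrank K L = 2) {ψ : AddChar K ℂ}
    (hψ : ψ.IsPrimitive) {C₀ : Subgroup Kˣ} (hneg : -(unitsSet C₀) = unitsSet C₀) {t : ℂ}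
    (ht : t ≠ 0) {E : Set K} (hE0 : (0 : K) ∉ E)
    (hE : ∀ y ≠ 0, fourierSum ψ ((unitsSet C₀).indicator 1) y =
      fourierSum ψ ((unitsSet C₀).indicator 1) 1 + t * E.indicator (1 : K → ℂ) y)
    {a : L} (ha : a ≠ 0) :
    fourierSum (traceChar L ψ) ((Algebra.norm K ⁻¹' E).indicator 1) a =
      E.ncard - Fintype.card K * (Algebra.norm K ⁻¹' E).indicator (1 : L → ℂ) a := by
  classical
  set f : K → ℂ := (unitsSet C₀).indicator 1 with hf
  set X := fourierSum ψ f with hX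
  have hX0 : X 0 = (unitsSet C₀).ncard := fourierSum_indicator_zero ψ _
  have hf0 : f 0 = 0 := Set.indicator_of_notMem (zero_notMem_unitsSet C₀) _
  have hfinv : ∀ c, f (-c⁻¹) = f c := by
    intro c
    simp only [hf, Set.indicator_apply, ← Set.mem_neg, hneg, inv_mem_unitsSet_iff, Pi.one_apply]
  have hD : ∀ x : L, (Algebra.norm K ⁻¹' E).indicator (1 : L → ℂ) x =
      E.indicator (1 : K → ℂ) (Algebra.norm K x) := fun x => rfl
  have hEall : ∀ y, t * E.indicator (1 : K → ℂ) y =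
      X y - X 1 - (if y = 0 then X 0 - X 1 else 0) := by
    intro y
    split_ifs with hy
    · rw [hy, Set.indicator_of_notMem hE0]
      ring
    · rw [hE y hy]
      ring
  -- Inversion at `0`, where the indicator of `C₀` vanishes.
  have hXsum : ∑ y, X y = 0 := by
    have := sum_fourierSum_mul hψ f 0
    simpa [hf0] using this
  have hEcard : t * E.ncard = -(Fintype.card K : ℂ) * X 1 - (X 0 - X 1) := by
    rw [← sum_indicator_one, Finset.mul_sum]
    simp only [hEall, Finset.sum_sub_distrib, hXsum]
    simp
  -- The eigenfunction identity for `X ∘ N`: one side is reindexed by `c ↦ -c⁻¹`, which preserves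
  -- `C₀`.
  have hmain : ∑ x : L, X (Algebra.norm K x) * traceChar L ψ (x * a) =
      -Fintype.card K * X (Algebra.norm K a) := by
    simp only [hX, fourierSum, Finset.sum_mul, Finset.mul_sum]
    rw [Finset.sum_comm, ← Equiv.sum_comp ((Equiv.inv K).trans (Equiv.neg K))]
    refine Finset.sum_congr rfl fun c _ => ?_
    simp only [Equiv.trans_apply, Equiv.inv_apply, Equiv.neg_apply, hfinv]
    rcases eq_or_ne c 0 with rfl | hc
    · simp [hf0]
    · have h1 := sum_addChar_norm_add_trace (L := L) hL hψ (c := -c⁻¹)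
        (neg_ne_zero.2 (inv_ne_zero hc)) a
      rw [inv_neg, inv_inv, neg_neg] at h1
      simp only [mul_assoc, ← Finset.mul_sum]
      rw [show ∑ i : L, ψ (-c⁻¹ * Algebra.norm K i) * traceChar L ψ (i * a) =
        ∑ i : L, ψ (Algebra.norm K i * -c⁻¹) * traceChar L ψ (i * a) from
        Finset.sum_congr rfl fun i _ => by rw [mul_comm (-c⁻¹)], h1]
      ring
  have hsum : t * fourierSum (traceChar L ψ) ((Algebra.norm K ⁻¹' E).indicator 1) a =
      -Fintype.card K * X (Algebra.norm K a) - (X 0 - X 1) := by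
    have h0 : ∑ x : L, traceChar L ψ (x * a) = 0 := by
      rw [sum_addChar_mul (isPrimitive_traceChar hψ), if_neg ha]
    rw [fourierSum, Finset.mul_sum]
    simp only [hD, ← mul_assoc, hEall, sub_mul, Finset.sum_sub_distrib, hmain, ← Finset.mul_sum,
      h0, Algebra.norm_eq_zero_iff]
    simp
  apply mul_left_cancel₀ ht
  have hNa : Algebra.norm K a ≠ 0 := Algebra.norm_ne_zero_iff.2 ha
  rw [hsum, hD, hE _ hNa]
  -- Subtracting `hEcard` cancels `X 0 - X 1` and leaves `-|K|` times `X (N a) - X 1`.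
  linear_combination -hEcard

theorem ncard_preimage_norm (hL : Module.finrank K L = 2) {E : Set K} (hE0 : (0 : K) ∉ E) :
    ((Algebra.norm K : L →* K) ⁻¹' E).ncard = E.ncard * (Fintype.card K + 1) := by
  have h1 := sum_comp_norm (L := L) hL (E.indicator 1)
  rw [sum_indicator_one, Set.indicator_of_notMem hE0] at h1
  have h2 : ∑ x : L, E.indicator (1 : K → ℂ) (Algebra.norm K x) =
      ((Algebra.norm K : L →* K) ⁻¹' E).ncard := (sum_indicator_one _)
  rw [h2] at h1
  have h3 : (((Algebra.norm K : L →* K) ⁻¹' E).ncard : ℂ) =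
      ((E.ncard * (Fintype.card K + 1) : ℕ) : ℂ) := by
    rw [h1]
    push_cast
    ring
  exact_mod_cast h3

end Norm

/-! ### Invariance on cosets and cyclotomic classes -/

section CosetInvariance

variable {F K : Type*} [Field F] [Field K] [Algebra F K]

/-- Inherited from the `C₀`-invariance of the character sums, which determine the difference. -/
theorem intersectionDiff_eq_of_mem [Fintype F] [Fintype K] {C₀ : Subgroup Kˣ}
    (hF : baseUnits F K ≤ C₀) {x y : Kˣ} (h : x⁻¹ * y ∈ C₀) :
    intersectionDiff F C₀ (QuotientGroup.mk y) = intersectionDiff F C₀ (QuotientGroup.mk x) := by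
  have hψ := AddChar.FiniteField.primitiveChar_to_Complex_isPrimitive F
  have h1 := fourierSum_unitsSet_eq hψ C₀ hF x
  have h2 := fourierSum_unitsSet_eq hψ C₀ hF y
  rw [show (y : K) = ((x⁻¹ * y : Kˣ) : K) * x by rw [← Units.val_mul, mul_right_comm,
    inv_mul_cancel, one_mul],
    fourierSum_unitsSet_mul _ (coe_mem_unitsSet.2 h), h1] at h2
  have hq : (Fintype.card F : ℂ) ≠ 0 := by simp
  exact_mod_cast (mul_left_cancel₀ hq (add_left_cancel h2)).symm

/-- The union of the cyclotomic classes indexed by `I` is the preimage under the norm of the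
elements at which the intersection difference is `δ`. -/
theorem iUnion_cyclotomicClass_eq [Fintype F] [Fintype K] {L : Type*} [Field L] [Algebra K L]
    [FiniteDimensional K L] {C₀ : Subgroup Kˣ} (hF : baseUnits F K ≤ C₀)
    {S : Set (Kˣ ⧸ baseUnits F K)}
    (hS : ∀ y : Kˣ, ∃ x : Kˣ, QuotientGroup.mk x ∈ S ∧ x⁻¹ * y ∈ C₀) {γ : Lˣ}
    (hγ : ∀ x : Lˣ, x ∈ Subgroup.zpowers γ) (δ : ℤ) :
    (⋃ i ∈ exponentSet F C₀ S δ (Units.map (Algebra.norm K : L →* K) γ) C₀.index,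
      cyclotomicClass γ C₀.index i) = (Algebra.norm K : L →* K) ⁻¹'
        {y | ∃ u : Kˣ, (u : K) = y ∧ intersectionDiff F C₀ (QuotientGroup.mk u) = δ} := by
  set N : Lˣ →* Kˣ := Units.map (Algebra.norm K : L →* K) with hN
  -- An index-`e` subgroup of an abelian group contains all `e`-th powers, so the norm sends the
  -- `i`-th class into the coset of `N γ ^ i`.
  have hpow : ∀ (i : ℕ) (k : ℤ), (N γ ^ i)⁻¹ * N (γ ^ i * (γ ^ C₀.index) ^ k) ∈ C₀ := by
    intro i k
    rw [map_mul, map_pow, inv_mul_cancel_left, map_zpow, map_pow]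
    exact C₀.zpow_mem (C₀.pow_index_mem _) k
  ext x
  simp only [Set.mem_iUnion, exists_prop, Set.mem_preimage, Set.mem_ofPred_eq]
  constructor
  · rintro ⟨i, ⟨-, s, ⟨-, hs⟩, hi⟩, ⟨_, ⟨_, ⟨k, rfl⟩, rfl⟩, rfl⟩⟩
    obtain ⟨v, rfl⟩ := QuotientGroup.mk_surjective s
    rw [mk_mem_smul_barSubgroup hF] at hi
    refine ⟨N (γ ^ i * (γ ^ C₀.index) ^ k), rfl, ?_⟩
    rw [intersectionDiff_eq_of_mem hF (hpow i k), intersectionDiff_eq_of_mem hF hi, hs]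
  · rintro ⟨u, hu, hδ⟩
    have hx : x ≠ 0 := by
      rintro rfl
      exact u.ne_zero (hu.trans (Algebra.norm_zero))
    lift x to Lˣ using hx.isUnit
    obtain ⟨j, rfl⟩ := hγ x
    have he : (C₀.index : ℤ) ≠ 0 := by
      exact_mod_cast Subgroup.index_ne_zero_of_finite
    obtain ⟨i, hi⟩ := Int.eq_ofNat_of_zero_le (Int.emod_nonneg j he)
    have hie : i < C₀.index := by
      have := Int.emod_lt_of_pos j (by positivity : (0 : ℤ) < C₀.index)
      omega
    have hj : γ ^ j = γ ^ i * (γ ^ C₀.index) ^ (j / C₀.index) := by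
      rw [← zpow_natCast γ i, ← zpow_natCast γ C₀.index, ← zpow_mul, ← zpow_add, ← hi,
        Int.emod_add_mul_ediv]
    have hu' : u = N (γ ^ j) := Units.ext hu
    obtain ⟨v, hvS, hv⟩ := hS (N γ ^ i)
    refine ⟨i, ⟨hie, QuotientGroup.mk v, ⟨hvS, ?_⟩, (mk_mem_smul_barSubgroup hF v _).2 hv⟩, ?_⟩
    · rw [← hδ, hu', hj, intersectionDiff_eq_of_mem hF (hpow i _),
        intersectionDiff_eq_of_mem hF hv]
    · exact ⟨_, ⟨_, ⟨j / C₀.index, rfl⟩, rfl⟩, congrArg Units.val hj.symm⟩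

end CosetInvariance

/-! ### The main theorem -/

theorem theorem3p1
    {F K L : Type*} [Field F] [Field K] [Field L] [Fintype F] [Fintype K] [Fintype L]
    [Algebra F K] [Algebra K L]
    (hm : 3 ≤ Module.finrank F K) (hL : Module.finrank K L = 2)
    (e : ℕ) (C₀ : Subgroup Kˣ)
    (hF : baseUnits F K ≤ C₀) (he : C₀.index = e)
    (hneg : -(unitsSet C₀) = unitsSet C₀)
    (hsrg : IsStronglyRegular (SimpleGraph.addCayley (unitsSet C₀)))
    (S : Set (Kˣ ⧸ baseUnits F K))
    (hS : Subgroup.IsComplement S (barSubgroup F C₀ : Set (Kˣ ⧸ baseUnits F K)))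
    (γ : Lˣ) (hγ : ∀ x : Lˣ, x ∈ Subgroup.zpowers γ)
    (ω : Kˣ) (hω : ω = Units.map (Algebra.norm K : L →* K) γ) :
    ∃ δ : ℤ, δ ≠ 0 ∧ intersectionDiff F C₀ '' S = {0, δ} ∧
      ∀ D : Set L, D = (⋃ i ∈ exponentSet F C₀ S δ ω e, cyclotomicClass γ e i) →
        IsConnectionSet D ∧ IsNegativeLatinSquareType (SimpleGraph.addCayley D) := by
  classical
  subst he hω
  have hψ := AddChar.FiniteField.primitiveChar_to_Complex_isPrimitive F
  set ψ := traceChar K (AddChar.FiniteField.primitiveChar_to_Complex F)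
  have hψK : ψ.IsPrimitive := isPrimitive_traceChar hψ
  set X := fourierSum ψ ((unitsSet C₀).indicator 1) with hX
  have hXeq : ∀ y : Kˣ, X y = X 1 +
      Fintype.card F * intersectionDiff F C₀ (QuotientGroup.mk y) :=
    fourierSum_unitsSet_eq hψ C₀ hF
  have hq : (Fintype.card F : ℂ) ≠ 0 := by simp
  have hcon : IsConnectionSet (unitsSet C₀) := ⟨zero_notMem_unitsSet C₀, hneg⟩
  -- Otherwise `C₀` is all of `K^*` and the graph is complete.
  obtain ⟨z, hz, hzC⟩ : ∃ z ≠ 0, z ∉ unitsSet C₀ := by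
    by_contra! h
    refine hsrg.2.1 ?_
    ext u v
    rw [hcon.addCayley_adj, SimpleGraph.top_adj]
    refine ⟨fun huv => ?_, fun huv => h _ (sub_ne_zero.2 huv.symm)⟩
    rintro rfl
    exact hcon.1 (by simpa using huv)
  obtain ⟨y₁, hy₁, hXy₁⟩ := exists_fourierSum_ne hψK (one_mem_unitsSet C₀) hz hzC (X 1)
  lift y₁ to Kˣ using hy₁.isUnit
  set δ := intersectionDiff F C₀ (QuotientGroup.mk y₁) with hδ
  have hδ0 : δ ≠ 0 := by
    intro h
    apply hXy₁
    rw [← hX, hXeq, ← hδ, h, Int.cast_zero, mul_zero, add_zero]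
  have hone : intersectionDiff F C₀ (QuotientGroup.mk (1 : Kˣ)) = 0 := by
    have := hXeq 1
    rw [Units.val_one, left_eq_add, mul_eq_zero] at this
    exact_mod_cast this.resolve_left hq
  have htwo : ∀ y : Kˣ, intersectionDiff F C₀ (QuotientGroup.mk y) = 0 ∨
      intersectionDiff F C₀ (QuotientGroup.mk y) = δ := by
    intro y
    obtain ⟨b, c, hbc⟩ := hcon.exists_quadratic hsrg hψK
    have k1 := hbc 1 one_ne_zero
    have k2 := hbc y₁ y₁.ne_zero
    have k3 := hbc y y.ne_zero
    rw [← hX] at k1 k2 k3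
    rw [hXeq] at k2 k3
    rw [← hδ] at k2
    set d := intersectionDiff F C₀ (QuotientGroup.mk y)
    have hδ' : (Fintype.card F : ℂ) * δ ≠ 0 := mul_ne_zero hq (by exact_mod_cast hδ0)
    -- Two distinct roots of `T² = bT + c` sum to `b`, so every nonzero difference from `X 1` equals
    -- `b - 2 X 1`.
    have e1 : (Fintype.card F : ℂ) * δ = b - 2 * X 1 := by
      apply mul_left_cancel₀ hδ'
      linear_combination k2 - k1
    by_cases hd : d = 0
    · exact Or.inl hd
    · right
      have hd' : (Fintype.card F : ℂ) * d ≠ 0 := mul_ne_zero hq (by exact_mod_cast hd)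
      have e2 : (Fintype.card F : ℂ) * d = b - 2 * X 1 := by
        apply mul_left_cancel₀ hd'
        linear_combination k3 - k1
      exact_mod_cast mul_left_cancel₀ hq (e2.trans e1.symm)
  have hS' : ∀ y : Kˣ, ∃ x : Kˣ, QuotientGroup.mk x ∈ S ∧ x⁻¹ * y ∈ C₀ := by
    intro y
    obtain ⟨⟨⟨s, hs⟩, ⟨b, hb⟩⟩, hsb⟩ := hS.2 (QuotientGroup.mk y)
    obtain ⟨x, rfl⟩ := QuotientGroup.mk_surjective s
    exact ⟨x, hs, (mk_mem_smul_barSubgroup hF x y).1 ⟨b, hb, hsb⟩⟩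
  refine ⟨δ, hδ0, ?_, ?_⟩
  · apply Set.Subset.antisymm
    · rintro _ ⟨s, -, rfl⟩
      obtain ⟨x, rfl⟩ := QuotientGroup.mk_surjective s
      exact htwo x
    · rintro _ (rfl | rfl)
      · obtain ⟨x, hx, hx1⟩ := hS' 1
        exact ⟨_, hx, by rw [← intersectionDiff_eq_of_mem hF hx1, hone]⟩
      · obtain ⟨x, hx, hx1⟩ := hS' y₁
        exact ⟨_, hx, by rw [← intersectionDiff_eq_of_mem hF hx1]⟩
  rintro D hD
  rw [iUnion_cyclotomicClass_eq hF hS' hγ] at hD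
  set E : Set K := {y | ∃ u : Kˣ, (u : K) = y ∧ intersectionDiff F C₀ (QuotientGroup.mk u) = δ}
  have hE0 : (0 : K) ∉ E := by
    rintro ⟨u, hu, -⟩
    exact u.ne_zero hu
  have hcoe : ∀ u : Kˣ, (u : K) ∈ E ↔ intersectionDiff F C₀ (QuotientGroup.mk u) = δ := by
    intro u
    constructor
    · rintro ⟨v, hv, h⟩
      rwa [← Units.ext hv]
    · exact fun h => ⟨u, rfl, h⟩
  have hE : ∀ y ≠ 0, X y = X 1 + (Fintype.card F * δ) * E.indicator (1 : K → ℂ) y := by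
    intro y hy
    lift y to Kˣ using hy.isUnit
    rcases htwo y with h | h
    · rw [hXeq, h, Set.indicator_of_notMem (fun hy => hδ0.symm (h ▸ (hcoe y).1 hy))]
      simp
    · rw [hXeq, h, Set.indicator_of_mem ((hcoe y).2 h)]
      simp
  have hDcon : IsConnectionSet D := by
    rw [hD]
    refine ⟨?_, ?_⟩
    · rw [Set.mem_preimage]
      erw [Algebra.norm_zero]
      exact hE0
    · ext x
      -- In degree two the norm of `-1` is `(-1)² = 1`, so `D` is symmetric.
      have : (Algebra.norm K : L →* K) (-x) = Algebra.norm K x := by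
        have h1 := Algebra.norm_algebraMap (S := L) (-1 : K)
        rw [hL, map_neg, map_one, neg_one_sq] at h1
        rw [← neg_one_mul, map_mul, h1, one_mul]
      rw [Set.mem_neg, Set.mem_preimage, Set.mem_preimage, this]
  have hsurj := FiniteField.norm_surjective K L
  -- A preimage of `y₁` lies in `D`, while `1` does not, its norm having difference `0 ≠ δ`; so the
  -- graph is neither edgeless nor complete.
  obtain ⟨d, hd⟩ := hsurj y₁
  refine ⟨hDcon, hDcon.isNegativeLatinSquareType (n := Fintype.card K) (r := E.ncard) (d := d)
    (z := 1) ?_ ?_ ?_ one_ne_zero ?_ (isPrimitive_traceChar hψK) ?_⟩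
  · rw [Module.card_eq_pow_finrank (K := K), hL]
  · rw [hD, ncard_preimage_norm hL hE0]
  · rw [hD, Set.mem_preimage]
    erw [hd]
    exact (hcoe y₁).2 rfl
  · rw [hD, Set.mem_preimage, map_one, ← Units.val_one, hcoe, hone]
    exact hδ0.symm
  · intro a ha
    rw [hD]
    exact fourierSum_preimage_norm hL hψK hneg (mul_ne_zero hq (by exact_mod_cast hδ0)) hE0 hE ha
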